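/- Let $T>0$, let $N\ge 1$, $I_N=\{1,\dots,N\}$, let $n_i,k_i,n_w$ be dimensions ($i\in I_N$), $n_x=\sum_i n_i$, $n_a=\sum_i k_i$, and let $A_i\subset\mathbb R^{k_i}$ be Borel sets. Let $b_i:[0,T]\times\mathbb R^{n_i}\times\mathbb R^{k_i}\to\mathbb R^{n_i}$, $\sigma_i:[0,T]\times\mathbb R^{n_i}\times\mathbb R^{k_i}\to\mathbb R^{n_i\times n_w}$, $f_i:[0,T]\times\mathbb R^{n_x}\times\mathbb R^{n_a}\to\mathbb R$ and $g_i:\mathbb R^{n_x}\to\mathbb R$ be measurable with $$\sup_{(t,x,a)}\frac{|f_i(t,x,a)|+|g_i(x)|}{1+|x|^2+|a|^2}<\infty ,\qquad i\in I_N .$$ Let $W$ be an $n_w$-dimensional Brownian motion on a probability space $(\Omega,\mathcal F,\mathbb P)$. An admissible (distributed) policy of agent $i$ is a measurable function $\phi_i:[0,T]\times\mathbb R^{n_i}\to A_i$ with $\sup_{t,x_i}|\phi_i(t,x_i)|/(1+|x_i|)<\infty$ such that for every $(t,x_i)\in[0,T]\times\mathbb R^{n_i}$ the equation $$dX^i_s=b_i(s,X^i_s,\phi_i(s,X^i_s))\,ds+\sigma_i(s,X^i_s,\phi_i(s,X^i_s))\,dW_s,\quad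 s\in[t,T];\qquad X^i_t=x_i,$$ has a square-integrable weak solution on $(\Omega,\mathcal F,\mathbb P)$ driven by $W$ (that is, a continuous solution, adapted to some filtration for which $W$ is a Brownian motion, with $\mathbb E[\sup_{s\in[t,T]}|X^i_s|^2]<\infty$), and all square-integrable weak solutions, on arbitrary probability spaces, have the same law. Let $\pi_i$ be the set of these policies and $\pi^{(N)}=\prod_i\pi_i$. For each $i$, $t$, $x_i$ and $\phi_i\in\pi_i$ fix such a solution $X^{t,x_i,\phi_i}$ on $(\Omega,\mathcal F,\mathbb P)$. For $x=(x_i)_i$ and $\phi=(\phi_i)_i\in\pi^{(N)}$ put $X^{t,x,\phi}=(X^{t,x_i,\phi_i})_{i}$ and $\alpha^{t,x,\phi}_s=(\phi_i(s,X^{t,x_i,\phi_i}_s))_{i}$. The value function of agent $i$ is $$V_i^{t,x}(\phi)=\mathbb E\Big[\int_t^T f_i(s,X^{t,x,\phi}_s,\alpha^{t,x,\phi}_s)\,ds+g_i(X^{t,x,\phi}_T)\Big].$$ Suppose that there are measurable functions $F:[0,T]\times\mathbb R^{n_x}\times\mathbb R^{n_a}\to\mathbb R$, $G:\mathbb R^{n_x}\to\mathbb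 R$, $U_{f_i}:[0,T]\times\prod_{j\ne i}\mathbb R^{n_j}\times\prod_{j\ne i}\mathbb R^{k_j}\to\mathbb R$ and $U_{g_i}:\prod_{j\ne i}\mathbb R^{n_j}\to\mathbb R$ such that for all $i\in I_N$ and all $(t,x,a)$ $$f_i(t,x,a)=F(t,x,a)+U_{f_i}(t,x_{-i},a_{-i}),\qquad g_i(x)=G(x)+U_{g_i}(x_{-i}),$$ where $x_{-i}=(x_j)_{j\ne i}$ and $a_{-i}=(a_j)_{j\neq i}$, and that $\int_0^T|F(t,\hat x,\hat a)|\,dt<\infty$ for some $(\hat x,\hat a)\in\mathbb R^{n_x}\times\mathbb R^{n_a}$. Then, for all $(t,x)\in[0,T]\times\mathbb R^{n_x}$ and $\phi\in\pi^{(N)}$, the expectations defining $V_i^{t,x}(\phi)$, $i\in I_N$, and $$\Phi^{t,x}(\phi)=\mathbb E\Big[\int_t^T F(s,X^{t,x,\phi}_s,\alpha^{t,x,\phi}_s)\,ds+G(X^{t,x,\phi}_T)\Big]$$ are well defined (the running terms are integrable over $[t,T]\times\Omega$ and the terminal terms over $\Omega$), and the game is a Markov potential game with potential function $\Phi$: for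 all $(t,x)\in[0,T]\times\mathbb R^{n_x}$, $i\in I_N$, $\phi\in\pi^{(N)}$ and $\phi_i'\in\pi_i$, $$\Phi^{t,x}((\phi_i',\phi_{-i}))-\Phi^{t,x}(\phi)=V_i^{t,x}((\phi_i',\phi_{-i}))-V_i^{t,x}(\phi).$$ -/

import Mathlib

open MeasureTheory ProbabilityTheory Filter Topology
open scoped ENNReal

universe u v

/-! ### Games, closed-loop potential games and Markov potential games -/

/-- A game with agents `ι`: a state space, the admissible policies of every agent, and the value
function `V_i^s(φ)` (expected cost) of every agent `i` at the state `s` under the profile `φ`. -/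
structure Game (ι : Type v) where
  State : Type u
  Policy : ι → Type u
  value : ι → State → (∀ i, Policy i) → ℝ

namespace Game

variable {ι : Type v} [DecidableEq ι] (G : Game.{u, v} ι)

/-- `Ψ` is a potential function of the game with initial state `s`: whenever one agent deviates
unilaterally, `Ψ` changes by as much as that agent's value function. -/
def IsPotentialAt (s : G.State) (Ψ : (∀ i, G.Policy i) → ℝ) : Prop :=
  ∀ (i : ι) (φ : ∀ j, G.Policy j) (φ' : G.Policy i),
    Ψ (Function.update φ i φ') - Ψ φ = G.value i s (Function.update φ i φ') - G.value i s φ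

/-- `Φ` is a potential function of the game for every initial state. -/
def IsMarkovPotential (Φ : G.State → (∀ i, G.Policy i) → ℝ) : Prop :=
  ∀ s, G.IsPotentialAt s (Φ s)

/-- A Markov potential game. -/
def IsMPG : Prop := ∃ Φ : G.State → (∀ i, G.Policy i) → ℝ, G.IsMarkovPotential Φ

end Game

/-! ### Brownian motion, the Itô integral and weak solutions on `[0, T]` -/

/-- The Euclidean space `ℝ^d`. -/
abbrev Euc (d : ℕ) : Type := EuclideanSpace ℝ (Fin d)

/-- The time interval `[0, T]`; for `t : Time T` the set `Set.Ici t` is `[t, T]`. -/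
abbrev Time (T : ℝ) : Type := ↥(Set.Icc (0 : ℝ) T)

/-- Lebesgue measure on `[0, T]`. -/
noncomputable def timeVol (T : ℝ) : Measure (Time T) := Measure.comap Subtype.val volume

section Stochastic

variable {Ω : Type u} [mΩ : MeasurableSpace Ω] {T : ℝ} {d m : ℕ}

/-- `W` is an `m`-dimensional standard Brownian motion on `[0, T]` relative to `𝔽`. -/
structure IsBrownianMotion (𝔽 : Filtration (Time T) mΩ) (P : Measure Ω)
    (W : Time T → Ω → Euc m) : Prop where
  adapted : ∀ s, Measurable[𝔽 s] (W s)
  initial : ∀ s : Time T, (s : ℝ) = 0 → ∀ᵐ ω ∂P, W s ω = 0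
  continuous : ∀ᵐ ω ∂P, Continuous fun s => W s ω
  increment_law : ∀ r s : Time T, r ≤ s →
    P.map (W s - W r) = multivariateGaussian 0 (((s : ℝ) - (r : ℝ)) • (1 : Matrix _ _ ℝ))
  increment_indep : ∀ r s : Time T, r ≤ s →
    Indep (MeasurableSpace.comap (W s - W r) inferInstance) (𝔽 r) P

/-- Simple (bounded, predictable step) matrix-valued integrands on `(t, T]`:
`∑_{k < K} ξ_k 1_{(τ_k, τ_{k+1}]}` with `ξ_k` bounded and `𝔽_{τ_k}`-measurable. -/
structure SimpleIntegrand (𝔽 : Filtration (Time T) mΩ) (d m : ℕ) (t : Time T) where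
  K : ℕ
  τ : ℕ → Time T
  τ_mono : Monotone τ
  start_le : ∀ k, t ≤ τ k
  ξ : ℕ → Ω → Matrix (Fin d) (Fin m) ℝ
  ξ_measurable : ∀ k p q, Measurable[𝔽 (τ k)] fun ω => ξ k ω p q
  ξ_bounded : ∃ C : ℝ, ∀ k ω p q, |ξ k ω p q| ≤ C

namespace SimpleIntegrand

variable {𝔽 : Filtration (Time T) mΩ} {t : Time T}

/-- The value `∑_{k < K} ξ_k 1_{(τ_k, τ_{k+1}]}(s)`. -/
noncomputable def val (H : SimpleIntegrand 𝔽 d m t) (s : Time T) (ω : Ω) :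
    Matrix (Fin d) (Fin m) ℝ :=
  ∑ k ∈ Finset.range H.K, (Set.Ioc (H.τ k) (H.τ (k + 1))).indicator (fun _ => H.ξ k ω) s

/-- The stochastic integral `∫_t^s H dW = ∑_{k < K} ξ_k (W_{τ_{k+1} ∧ s} - W_{τ_k ∧ s})`. -/
noncomputable def integral (H : SimpleIntegrand 𝔽 d m t) (W : Time T → Ω → Euc m)
    (s : Time T) (ω : Ω) : Euc d :=
  ∑ k ∈ Finset.range H.K,
    (WithLp.toLp 2 ((H.ξ k ω).mulVec
      (W (min (H.τ (k + 1)) s) ω - W (min (H.τ k) s) ω).ofLp) : Euc d)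

end SimpleIntegrand

/-- `M_s = ∫_t^s H_r dW_r` for every `s ∈ [t, T]` (almost surely, for each `s`): there are simple
integrands `S_n` with `∫_t^T |S_n - H|² dr → 0` in probability and `∫_t^s S_n dW → M_s` in
probability. -/
def IsItoIntegral (𝔽 : Filtration (Time T) mΩ) (P : Measure Ω) (W : Time T → Ω → Euc m)
    (t : Time T) (H : Time T → Ω → Matrix (Fin d) (Fin m) ℝ) (M : Time T → Ω → Euc d) : Prop :=
  ∃ S : ℕ → SimpleIntegrand 𝔽 d m t,
    (∀ ε : ℝ≥0∞, 0 < ε → Tendsto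
      (fun n => P {ω | ε ≤
        ∫⁻ r in Set.Ici t, ∑ p, ∑ q, ‖(S n).val r ω p q - H r ω p q‖ₑ ^ 2 ∂(timeVol T)})
      atTop (𝓝 0)) ∧
    ∀ s, t ≤ s → TendstoInMeasure P (fun n ω => (S n).integral W s ω) atTop (M s)

/-- On the filtered probability space `(Ω, 𝔽, P)` with the `𝔽`-Brownian motion `W`, the process
`X` solves `dX_s = b(s, X_s) ds + σ(s, X_s) dW_s` on `[t, T]`, `X_t = x`.
The values `X_s` with `s < t` play no role. -/
structure SolvesSDE (𝔽 : Filtration (Time T) mΩ) (P : Measure Ω) (W : Time T → Ω → Euc m)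
    (b : Time T → Euc d → Euc d) (σ : Time T → Euc d → Matrix (Fin d) (Fin m) ℝ)
    (t : Time T) (x : Euc d) (X : Time T → Ω → Euc d) : Prop where
  brownian : IsBrownianMotion 𝔽 P W
  adapted : ∀ s, t ≤ s → Measurable[𝔽 s] (X s)
  continuous : ∀ᵐ ω ∂P, ContinuousOn (fun s => X s ω) (Set.Ici t)
  drift_integrable : ∀ᵐ ω ∂P, IntegrableOn (fun s => b s (X s ω)) (Set.Ici t) (timeVol T)
  diffusion_sq_integrable :
    ∀ᵐ ω ∂P, ∫⁻ s in Set.Ici t, ∑ p, ∑ q, ‖σ s (X s ω) p q‖ₑ ^ 2 ∂(timeVol T) < ∞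
  initial : ∀ᵐ ω ∂P, X t ω = x
  equation : IsItoIntegral 𝔽 P W t (fun s ω => σ s (X s ω))
    (fun s ω => X s ω - x - ∫ r in Set.Icc t s, b r (X r ω) ∂(timeVol T))

/-- `X` is a square-integrable weak solution on `(Ω, P)` with the Brownian motion `W`: it solves
the equation relative to some filtration, and `E[sup_{s ∈ [t, T]} |X_s|²] < ∞`. -/
def IsSqIntWeakSolution (P : Measure Ω) (W : Time T → Ω → Euc m)
    (b : Time T → Euc d → Euc d) (σ : Time T → Euc d → Matrix (Fin d) (Fin m) ℝ)
    (t : Time T) (x : Euc d) (X : Time T → Ω → Euc d) : Prop :=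
  (∃ 𝔽 : Filtration (Time T) mΩ, SolvesSDE 𝔽 P W b σ t x X) ∧
    ∫⁻ ω, ⨆ s ∈ Set.Ici t, ‖X s ω‖ₑ ^ 2 ∂P < ∞

/-- The law of `(X_s)_{s ∈ [t, T]}`, as a measure on the product space; for continuous processes
it determines, and is determined by, the law on path space. -/
noncomputable def lawFrom (P : Measure Ω) (t : Time T) (X : Time T → Ω → Euc d) :
    Measure (↥(Set.Ici t) → Euc d) :=
  P.map fun ω s => X s ω

/-- The equation has a square-integrable weak solution on `(Ω, P)` with the Brownian motion `W`,
and every square-integrable weak solution, on whatever probability space and with whatever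
Brownian motion, has the same law. -/
def HasUniqueSqIntWeakSolution (P : Measure Ω) (W : Time T → Ω → Euc m)
    (b : Time T → Euc d → Euc d) (σ : Time T → Euc d → Matrix (Fin d) (Fin m) ℝ)
    (t : Time T) (x : Euc d) : Prop :=
  (∃ X : Time T → Ω → Euc d, IsSqIntWeakSolution P W b σ t x X) ∧
  ∀ X : Time T → Ω → Euc d, IsSqIntWeakSolution P W b σ t x X →
    ∀ (Ω' : Type) (_ : MeasurableSpace Ω') (P' : Measure Ω') (_ : IsProbabilityMeasure P')
      (W' : Time T → Ω' → Euc m) (X' : Time T → Ω' → Euc d),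
      IsSqIntWeakSolution P' W' b σ t x X' → lawFrom P' t X' = lawFrom P t X

end Stochastic

/-! ### Distributed games -/

/-- The data of a distributed game with `N` agents: horizon, dimensions, action sets, state
coefficients, costs of at most quadratic growth, and a probability space with a Brownian motion. -/
structure DistributedGame (N : ℕ) where
  T : ℝ
  T_pos : 0 < T
  /-- dimension of the state of agent `i` -/
  n : Fin N → ℕ
  /-- dimension of the action of agent `i` -/
  k : Fin N → ℕ
  /-- dimension of the Brownian motion -/
  nw : ℕ
  A : ∀ i, Set (Euc (k i))
  A_measurable : ∀ i, MeasurableSet (A i)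
  b : ∀ i, Time T → Euc (n i) → Euc (k i) → Euc (n i)
  b_measurable : ∀ i,
    Measurable fun z : Time T × Euc (n i) × Euc (k i) => b i z.1 z.2.1 z.2.2
  σ : ∀ i, Time T → Euc (n i) → Euc (k i) → Matrix (Fin (n i)) (Fin nw) ℝ
  σ_measurable : ∀ i p q,
    Measurable fun z : Time T × Euc (n i) × Euc (k i) => σ i z.1 z.2.1 z.2.2 p q
  f : Fin N → Time T → (∀ i, Euc (n i)) → (∀ i, Euc (k i)) → ℝ
  f_measurable : ∀ i,
    Measurable fun z : Time T × (∀ i, Euc (n i)) × (∀ i, Euc (k i)) => f i z.1 z.2.1 z.2.2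
  g : Fin N → (∀ i, Euc (n i)) → ℝ
  g_measurable : ∀ i, Measurable (g i)
  growth : ∀ i, ∃ C : ℝ, ∀ t x a,
    |f i t x a| + |g i x| ≤ C * (1 + ∑ j, ‖x j‖ ^ 2 + ∑ j, ‖a j‖ ^ 2)
  Ω : Type u
  mΩ : MeasurableSpace Ω
  P : Measure Ω
  isProb : IsProbabilityMeasure P
  W : Time T → Ω → Euc nw
  W_brownian : ∃ 𝔽 : Filtration (Time T) mΩ, IsBrownianMotion 𝔽 P W

namespace DistributedGame

attribute [instance] DistributedGame.mΩ DistributedGame.isProb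

variable {N : ℕ} (𝒢 : DistributedGame.{u} N)

/-- The terminal time `T` as a point of `[0, T]`. -/
def terminal : Time 𝒢.T := ⟨𝒢.T, 𝒢.T_pos.le, le_rfl⟩

/-- The joint states `∏ i, ℝ^{n_i}`. -/
abbrev JointState : Type := ∀ i, Euc (𝒢.n i)

/-- The joint actions `∏ i, ℝ^{k_i}`. -/
abbrev JointAction : Type := ∀ i, Euc (𝒢.k i)

/-- The admissible distributed policies of agent `i`: measurable functions of time and of the
agent's own state, with values in `A i`, of linear growth, for which the state equation of
agent `i` has a unique square-integrable weak solution from every initial condition. -/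
structure Policy (i : Fin N) where
  act : Time 𝒢.T → Euc (𝒢.n i) → ↥(𝒢.A i)
  measurable : Measurable fun z : Time 𝒢.T × Euc (𝒢.n i) => act z.1 z.2
  linear_growth : ∃ C : ℝ, ∀ t y, ‖(act t y : Euc (𝒢.k i))‖ ≤ C * (1 + ‖y‖)
  wellPosed : ∀ t y, HasUniqueSqIntWeakSolution 𝒢.P 𝒢.W
    (fun s z => 𝒢.b i s z (act s z)) (fun s z => 𝒢.σ i s z (act s z)) t y

/-- The state processes: for every agent `i`, initial condition `(t, x_i)` and admissible policy
`φ_i` of that agent, a square-integrable weak solution `X^{t, x_i, φ_i}` of the state equation of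
agent `i`, all on `(Ω, P)` and driven by `W`. -/
structure StateProcesses where
  X : ∀ i, Time 𝒢.T → Euc (𝒢.n i) → 𝒢.Policy i → Time 𝒢.T → 𝒢.Ω → Euc (𝒢.n i)
  solves : ∀ i t y (φ : 𝒢.Policy i), IsSqIntWeakSolution 𝒢.P 𝒢.W
    (fun s z => 𝒢.b i s z (φ.act s z)) (fun s z => 𝒢.σ i s z (φ.act s z)) t y (X i t y φ)

variable {𝒢}

namespace StateProcesses

variable (𝒳 : 𝒢.StateProcesses)

/-- The joint state process `X^{t,x,φ}_s = (X^{t,x_i,φ_i}_s)_i`. -/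
def state (t : Time 𝒢.T) (x : 𝒢.JointState) (φ : ∀ i, 𝒢.Policy i)
    (s : Time 𝒢.T) (ω : 𝒢.Ω) : 𝒢.JointState :=
  fun i => 𝒳.X i t (x i) (φ i) s ω

/-- The joint control process `α^{t,x,φ}_s = (φ_i(s, X^{t,x_i,φ_i}_s))_i`. -/
def control (t : Time 𝒢.T) (x : 𝒢.JointState) (φ : ∀ i, 𝒢.Policy i)
    (s : Time 𝒢.T) (ω : 𝒢.Ω) : 𝒢.JointAction :=
  fun i => ((φ i).act s (𝒳.X i t (x i) (φ i) s ω) : Euc (𝒢.k i))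

/-- `E[∫_t^T ℓ(s, X_s, α_s) ds + h(X_T)]` with `X = X^{t,x,φ}` and `α = α^{t,x,φ}`. -/
noncomputable def expectedCost (ℓ : Time 𝒢.T → 𝒢.JointState → 𝒢.JointAction → ℝ)
    (h : 𝒢.JointState → ℝ) (t : Time 𝒢.T) (x : 𝒢.JointState) (φ : ∀ i, 𝒢.Policy i) : ℝ :=
  ∫ ω, ((∫ s in Set.Ici t, ℓ s (𝒳.state t x φ s ω) (𝒳.control t x φ s ω) ∂(timeVol 𝒢.T)) +
    h (𝒳.state t x φ 𝒢.terminal ω)) ∂𝒢.P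

/-- `expectedCost ℓ h t x φ` is well defined: `ℓ(s, X_s, α_s)` is integrable over `[t, T] × Ω`
and `h(X_T)` is integrable. -/
def CostWellDefined (ℓ : Time 𝒢.T → 𝒢.JointState → 𝒢.JointAction → ℝ)
    (h : 𝒢.JointState → ℝ) (t : Time 𝒢.T) (x : 𝒢.JointState) (φ : ∀ i, 𝒢.Policy i) : Prop :=
  Integrable (fun z : Time 𝒢.T × 𝒢.Ω => ℓ z.1 (𝒳.state t x φ z.1 z.2) (𝒳.control t x φ z.1 z.2))
    (((timeVol 𝒢.T).restrict (Set.Ici t)).prod 𝒢.P) ∧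
  Integrable (fun ω => h (𝒳.state t x φ 𝒢.terminal ω)) 𝒢.P

/-- The distributed game: its states are the pairs `(t, x)`, and
`V_i^{t,x}(φ) = E[∫_t^T f_i(s, X_s, α_s) ds + g_i(X_T)]`. -/
noncomputable def toGame : Game.{0, 0} (Fin N) where
  State := Time 𝒢.T × 𝒢.JointState
  Policy := 𝒢.Policy
  value i s φ := 𝒳.expectedCost (𝒢.f i) (𝒢.g i) s.1 s.2 φ

end StateProcesses

end DistributedGame

/-! The two halves of the statement are integrability and a cancellation.

*Integrability.* A unilateral change of the state and action of agent `i` changes `F` by as much as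
`f_i`, which has quadratic growth. Passing from a reference point to `(x, a)` by changing one agent
at a time, `abs_sub_le_of_potential` bounds `|F(t, x, a) - F(t, x₀, a₀)|` by a multiple of
`1 + |x|² + |a|²`; the same argument applies to `G`. Since `F(·, x₀, a₀)` is integrable in time and
the solutions are square integrable, uniformly in time, the costs are integrable
(`StateProcesses.costWellDefined_of_growth`); joint measurability of the solutions in time and
chance follows from the continuity of their paths.

*Cancellation.* By Fubini the expected cost is additive in the cost functions, so `V_i - Φ` is the
expected cost of `U_{f_i}`, `U_{g_i}`. Policies are distributed: the state and action of agent `j`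
depend on the policy of `j` alone. Hence `V_i - Φ` does not see a deviation of agent `i`.
-/

/-! ### Growth of potentials -/

/-- A function whose unilateral differences are those of functions `h i` dominated by a separable
weight is itself dominated by that weight, up to its value at a reference point `z₀`. -/
theorem abs_sub_le_of_potential {ι : Type*} [Fintype ι] [DecidableEq ι] {S : ι → Type*}
    {w : ∀ i, S i → ℝ} (hw : ∀ i y, 0 ≤ w i y) {H : (∀ i, S i) → ℝ} {h : ι → (∀ i, S i) → ℝ}
    (hpot : ∀ i z y, H (Function.update z i y) - H z = h i (Function.update z i y) - h i z)
    {C : ι → ℝ} (hC : ∀ i z, |h i z| ≤ C i * (1 + ∑ j, w j (z j))) (z₀ z : ∀ i, S i) :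
    |H z - H z₀| ≤ 2 * (∑ i, C i) * (1 + ∑ j, w j (z₀ j) + ∑ j, w j (z j)) := by
  have hC0 : ∀ i, 0 ≤ C i := fun i =>
    nonneg_of_mul_nonneg_left ((abs_nonneg _).trans (hC i z₀))
      (by have := Finset.sum_nonneg fun j (_ : j ∈ Finset.univ) => hw j (z₀ j); linarith)
  set Q : ℝ := 1 + ∑ j, w j (z₀ j) + ∑ j, w j (z j) with hQ
  have hmix : ∀ s : Finset ι, 1 + ∑ j, w j (s.piecewise z z₀ j) ≤ Q := by
    intro s
    rw [hQ, add_assoc, ← Finset.sum_add_distrib]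
    gcongr with j
    have h₁ := hw j (z j)
    have h₂ := hw j (z₀ j)
    by_cases hj : j ∈ s <;> simp [hj] <;> linarith
  have key : ∀ s : Finset ι, |H (s.piecewise z z₀) - H z₀| ≤ 2 * (∑ i ∈ s, C i) * Q := by
    intro s
    induction s using Finset.induction_on with
    | empty => simp
    | insert i s hi ih =>
      have hstep := hpot i (s.piecewise z z₀) (z i)
      rw [← Finset.piecewise_insert] at hstep
      have b₁ := (hC i ((insert i s).piecewise z z₀)).trans
        (mul_le_mul_of_nonneg_left (hmix (insert i s)) (hC0 i))
      have b₂ := (hC i (s.piecewise z z₀)).trans (mul_le_mul_of_nonneg_left (hmix s) (hC0 i))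
      rw [Finset.sum_insert hi]
      rw [abs_le] at *
      constructor <;> linarith [b₁.1, b₁.2, b₂.1, b₂.2, ih.1, ih.2]
  simpa using key Finset.univ

/-! ### Measurability and integrability of solutions -/

instance isFiniteMeasure_timeVol (T : ℝ) : IsFiniteMeasure (timeVol T) := by
  refine ⟨?_⟩
  rw [timeVol, Measure.comap_apply _ Subtype.val_injective
    (fun s hs => measurableSet_Icc.subtype_image hs) _ MeasurableSet.univ]
  rw [Set.image_univ, Subtype.range_coe, Real.volume_Icc]
  exact ENNReal.ofReal_lt_top

namespace IsSqIntWeakSolution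

variable {Ω : Type u} [MeasurableSpace Ω] {T : ℝ} {d m : ℕ} {P : Measure Ω}
  {W : Time T → Ω → Euc m} {b : Time T → Euc d → Euc d}
  {σ : Time T → Euc d → Matrix (Fin d) (Fin m) ℝ} {t : Time T} {x : Euc d}
  {X : Time T → Ω → Euc d}

theorem measurable (hX : IsSqIntWeakSolution P W b σ t x X) {s : Time T} (hs : t ≤ s) :
    Measurable (X s) := by
  obtain ⟨⟨𝔽, h𝔽⟩, -⟩ := hX
  exact (h𝔽.adapted s hs).mono (𝔽.le s) le_rfl

/-- The process frozen before time `t`, and set to zero on a null set that contains all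
discontinuous paths, is continuous in time and measurable in `ω`, hence jointly measurable. -/
theorem aemeasurable_uncurry [SFinite P] (hX : IsSqIntWeakSolution P W b σ t x X) :
    AEMeasurable (fun z : Time T × Ω => X z.1 z.2)
      (((timeVol T).restrict (Set.Ici t)).prod P) := by
  have hcont : ∀ᵐ ω ∂P, ContinuousOn (fun s => X s ω) (Set.Ici t) := by
    obtain ⟨⟨𝔽, h𝔽⟩, -⟩ := hX
    exact h𝔽.continuous
  obtain ⟨B, hBP, hBm, hB⟩ := hcont.exists_measurable_mem
  refine ⟨fun z => B.indicator (X (max t z.1)) z.2, ?_, ?_⟩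
  · have : Measurable (Function.uncurry fun (s : Time T) (ω : Ω) =>
        B.indicator (X (max t s)) ω) := by
      refine measurable_uncurry_of_continuous_of_measurable (fun ω => ?_)
        (fun s => (hX.measurable (le_max_left t s)).indicator hBm)
      by_cases hω : ω ∈ B
      · simp only [Set.indicator_of_mem hω]
        exact (hB ω hω).comp_continuous (by fun_prop) fun s => le_max_left t s
      · simp only [Set.indicator_of_notMem hω]
        exact continuous_const
    exact this
  · have h₁ : ∀ᵐ z ∂((timeVol T).restrict (Set.Ici t)).prod P, z.1 ∈ Set.Ici t :=
      Measure.quasiMeasurePreserving_fst.ae (ae_restrict_mem measurableSet_Ici)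
    have h₂ : ∀ᵐ z ∂((timeVol T).restrict (Set.Ici t)).prod P, z.2 ∈ B :=
      Measure.quasiMeasurePreserving_snd.ae hBP
    filter_upwards [h₁, h₂] with z hz₁ hz₂
    rw [Set.indicator_of_mem hz₂, max_eq_right hz₁]

theorem lintegral_sq_le {s : Time T} (hs : t ≤ s) :
    ∫⁻ ω, ‖X s ω‖ₑ ^ 2 ∂P ≤ ∫⁻ ω, ⨆ s ∈ Set.Ici t, ‖X s ω‖ₑ ^ 2 ∂P :=
  lintegral_mono fun ω => le_iSup₂ (f := fun s (_ : s ∈ Set.Ici t) => ‖X s ω‖ₑ ^ 2) s hs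

theorem integrable_sq (hX : IsSqIntWeakSolution P W b σ t x X) {s : Time T} (hs : t ≤ s) :
    Integrable (fun ω => ‖X s ω‖ ^ 2) P := by
  refine ⟨((hX.measurable hs).norm.pow_const 2).aestronglyMeasurable, ?_⟩
  rw [HasFiniteIntegral]
  simp only [enorm_pow, enorm_norm]
  exact (lintegral_sq_le hs).trans_lt hX.2

theorem integrable_sq_uncurry [SFinite P] (hX : IsSqIntWeakSolution P W b σ t x X) :
    Integrable (fun z : Time T × Ω => ‖X z.1 z.2‖ ^ 2)
      (((timeVol T).restrict (Set.Ici t)).prod P) := by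
  refine ⟨(hX.aemeasurable_uncurry.norm.pow_const 2).aestronglyMeasurable, ?_⟩
  rw [HasFiniteIntegral]
  simp only [enorm_pow, enorm_norm]
  rw [lintegral_prod _ (hX.aemeasurable_uncurry.enorm.pow_const 2)]
  calc ∫⁻ s in Set.Ici t, ∫⁻ ω, ‖X s ω‖ₑ ^ 2 ∂P ∂(timeVol T)
      ≤ ∫⁻ _ in Set.Ici t, ∫⁻ ω, ⨆ s ∈ Set.Ici t, ‖X s ω‖ₑ ^ 2 ∂P ∂(timeVol T) :=
        setLIntegral_mono' measurableSet_Ici fun s hs => lintegral_sq_le hs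
    _ < ∞ := by
        rw [lintegral_const]
        exact ENNReal.mul_lt_top hX.2 (measure_lt_top _ _)

end IsSqIntWeakSolution

/-! ### Expected costs -/

namespace DistributedGame

variable {N : ℕ} {𝒢 : DistributedGame.{u} N}

namespace StateProcesses

variable (𝒳 : 𝒢.StateProcesses)

theorem le_terminal (t : Time 𝒢.T) : t ≤ 𝒢.terminal := t.2.2

theorem aemeasurable_state (t : Time 𝒢.T) (x : 𝒢.JointState) (φ : ∀ i, 𝒢.Policy i) :
    AEMeasurable (fun z : Time 𝒢.T × 𝒢.Ω => 𝒳.state t x φ z.1 z.2)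
      (((timeVol 𝒢.T).restrict (Set.Ici t)).prod 𝒢.P) :=
  aemeasurable_pi_lambda _ fun i => (𝒳.solves i t (x i) (φ i)).aemeasurable_uncurry

theorem aemeasurable_control (t : Time 𝒢.T) (x : 𝒢.JointState) (φ : ∀ i, 𝒢.Policy i) :
    AEMeasurable (fun z : Time 𝒢.T × 𝒢.Ω => 𝒳.control t x φ z.1 z.2)
      (((timeVol 𝒢.T).restrict (Set.Ici t)).prod 𝒢.P) :=
  aemeasurable_pi_lambda _ fun i =>
    (measurable_subtype_coe.comp (φ i).measurable).comp_aemeasurable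
      (measurable_fst.aemeasurable.prodMk (𝒳.solves i t (x i) (φ i)).aemeasurable_uncurry)

theorem measurable_state_terminal (t : Time 𝒢.T) (x : 𝒢.JointState) (φ : ∀ i, 𝒢.Policy i) :
    Measurable (𝒳.state t x φ 𝒢.terminal) :=
  measurable_pi_lambda _ fun i => (𝒳.solves i t (x i) (φ i)).measurable (le_terminal t)

theorem integrable_control_sq (t : Time 𝒢.T) (x : 𝒢.JointState) (φ : ∀ i, 𝒢.Policy i)
    (i : Fin N) :
    Integrable (fun z : Time 𝒢.T × 𝒢.Ω => ‖𝒳.control t x φ z.1 z.2 i‖ ^ 2)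
      (((timeVol 𝒢.T).restrict (Set.Ici t)).prod 𝒢.P) := by
  obtain ⟨C, hC⟩ := (φ i).linear_growth
  have hX := (𝒳.solves i t (x i) (φ i)).integrable_sq_uncurry
  refine Integrable.mono' (((integrable_const (1 : ℝ)).add hX).const_mul (2 * C ^ 2))
    (((aemeasurable_pi_iff.1 (𝒳.aemeasurable_control t x φ) i).norm.pow_const
      2).aestronglyMeasurable) (Eventually.of_forall fun z => ?_)
  rw [Real.norm_of_nonneg (by positivity)]
  calc ‖𝒳.control t x φ z.1 z.2 i‖ ^ 2
      ≤ (C * (1 + ‖𝒳.X i t (x i) (φ i) z.1 z.2‖)) ^ 2 :=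
        pow_le_pow_left₀ (norm_nonneg _) (hC _ _) 2
    _ = C ^ 2 * (1 + ‖𝒳.X i t (x i) (φ i) z.1 z.2‖) ^ 2 := mul_pow ..
    _ ≤ C ^ 2 * (2 * (1 ^ 2 + ‖𝒳.X i t (x i) (φ i) z.1 z.2‖ ^ 2)) := by
        gcongr
        exact add_sq_le
    _ = 2 * C ^ 2 * (1 + ‖𝒳.X i t (x i) (φ i) z.1 z.2‖ ^ 2) := by ring

/-- Costs of quadratic growth, up to an integrable function of time, have well-defined
expectations. -/
theorem costWellDefined_of_growth {ℓ : Time 𝒢.T → 𝒢.JointState → 𝒢.JointAction → ℝ}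
    {h : 𝒢.JointState → ℝ}
    (hℓ : Measurable fun z : Time 𝒢.T × 𝒢.JointState × 𝒢.JointAction => ℓ z.1 z.2.1 z.2.2)
    (hh : Measurable h) {κ : Time 𝒢.T → ℝ} (hκ : Integrable κ (timeVol 𝒢.T)) {C D : ℝ}
    (hℓ_le : ∀ s y a, |ℓ s y a| ≤ κ s + C * (1 + ∑ j, ‖y j‖ ^ 2 + ∑ j, ‖a j‖ ^ 2))
    (hh_le : ∀ y, |h y| ≤ D * (1 + ∑ j, ‖y j‖ ^ 2))
    (t : Time 𝒢.T) (x : 𝒢.JointState) (φ : ∀ i, 𝒢.Policy i) :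
    𝒳.CostWellDefined ℓ h t x φ := by
  refine ⟨?_, ?_⟩
  · have hX := integrable_finsetSum Finset.univ fun i _ =>
      (𝒳.solves i t (x i) (φ i)).integrable_sq_uncurry
    have hα := integrable_finsetSum Finset.univ fun i _ => 𝒳.integrable_control_sq t x φ i
    refine Integrable.mono' ((hκ.restrict.comp_fst 𝒢.P).add
      ((((integrable_const (1 : ℝ)).add hX).add hα).const_mul C)) ?_
      (Eventually.of_forall fun z => hℓ_le _ _ _)
    exact (hℓ.comp_aemeasurable (measurable_fst.aemeasurable.prodMk
      ((𝒳.aemeasurable_state t x φ).prodMk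
        (𝒳.aemeasurable_control t x φ)))).aestronglyMeasurable
  · have hX := integrable_finsetSum Finset.univ fun i _ =>
      (𝒳.solves i t (x i) (φ i)).integrable_sq (le_terminal t)
    exact Integrable.mono' (((integrable_const (1 : ℝ)).add hX).const_mul D)
      (hh.comp (𝒳.measurable_state_terminal t x φ)).aestronglyMeasurable
      (Eventually.of_forall fun ω => hh_le _)

theorem integrable_integral_running {ℓ : Time 𝒢.T → 𝒢.JointState → 𝒢.JointAction → ℝ}
    {h : 𝒢.JointState → ℝ} {t : Time 𝒢.T} {x : 𝒢.JointState} {φ : ∀ i, 𝒢.Policy i}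
    (H : 𝒳.CostWellDefined ℓ h t x φ) :
    Integrable (fun ω => ∫ s in Set.Ici t, ℓ s (𝒳.state t x φ s ω) (𝒳.control t x φ s ω)
      ∂(timeVol 𝒢.T)) 𝒢.P :=
  H.1.integral_prod_right

theorem expectedCost_eq {ℓ : Time 𝒢.T → 𝒢.JointState → 𝒢.JointAction → ℝ}
    {h : 𝒢.JointState → ℝ} {t : Time 𝒢.T} {x : 𝒢.JointState} {φ : ∀ i, 𝒢.Policy i}
    (H : 𝒳.CostWellDefined ℓ h t x φ) :
    𝒳.expectedCost ℓ h t x φ =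
      (∫ z : Time 𝒢.T × 𝒢.Ω, ℓ z.1 (𝒳.state t x φ z.1 z.2) (𝒳.control t x φ z.1 z.2)
        ∂(((timeVol 𝒢.T).restrict (Set.Ici t)).prod 𝒢.P)) +
      ∫ ω, h (𝒳.state t x φ 𝒢.terminal ω) ∂𝒢.P := by
  rw [expectedCost, integral_add (𝒳.integrable_integral_running H) H.2, integral_prod_symm _ H.1]

theorem expectedCost_sub {ℓ ℓ' : Time 𝒢.T → 𝒢.JointState → 𝒢.JointAction → ℝ}
    {h h' : 𝒢.JointState → ℝ} {t : Time 𝒢.T} {x : 𝒢.JointState} {φ : ∀ i, 𝒢.Policy i}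
    (H : 𝒳.CostWellDefined ℓ h t x φ) (H' : 𝒳.CostWellDefined ℓ' h' t x φ) :
    𝒳.expectedCost ℓ h t x φ - 𝒳.expectedCost ℓ' h' t x φ =
      𝒳.expectedCost (fun s y a => ℓ s y a - ℓ' s y a) (fun y => h y - h' y) t x φ := by
  have Hsub : 𝒳.CostWellDefined (fun s y a => ℓ s y a - ℓ' s y a) (fun y => h y - h' y) t x φ :=
    ⟨H.1.sub H'.1, H.2.sub H'.2⟩
  rw [𝒳.expectedCost_eq H, 𝒳.expectedCost_eq H', 𝒳.expectedCost_eq Hsub,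
    integral_sub H.1 H'.1, integral_sub H.2 H'.2]
  ring

/-- Policies are distributed: a cost that does not depend on the state and action of agent `i` has
the same expectation after a deviation of agent `i`. -/
theorem expectedCost_update (i : Fin N)
    (u : Time 𝒢.T → (∀ j : {j : Fin N // j ≠ i}, Euc (𝒢.n j)) →
      (∀ j : {j : Fin N // j ≠ i}, Euc (𝒢.k j)) → ℝ)
    (v : (∀ j : {j : Fin N // j ≠ i}, Euc (𝒢.n j)) → ℝ) (t : Time 𝒢.T) (x : 𝒢.JointState)
    (φ : ∀ j, 𝒢.Policy j) (φ' : 𝒢.Policy i) :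
    𝒳.expectedCost (fun s y a => u s (fun j => y j.1) (fun j => a j.1)) (fun y => v (fun j => y j.1))
        t x (Function.update φ i φ') =
      𝒳.expectedCost (fun s y a => u s (fun j => y j.1) (fun j => a j.1))
        (fun y => v (fun j => y j.1)) t x φ := by
  have hstate : ∀ (s : Time 𝒢.T) (ω : 𝒢.Ω), (fun j : {j : Fin N // j ≠ i} =>
      𝒳.state t x (Function.update φ i φ') s ω j.1) =
        fun j : {j : Fin N // j ≠ i} => 𝒳.state t x φ s ω j.1 := by
    intro s ω
    funext j
    simp only [state, Function.update_of_ne j.2]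
  have hcontrol : ∀ (s : Time 𝒢.T) (ω : 𝒢.Ω), (fun j : {j : Fin N // j ≠ i} =>
      𝒳.control t x (Function.update φ i φ') s ω j.1) =
        fun j : {j : Fin N // j ≠ i} => 𝒳.control t x φ s ω j.1 := by
    intro s ω
    funext j
    simp only [control, Function.update_of_ne j.2]
  simp only [expectedCost, hstate, hcontrol]

end StateProcesses

/-! ### Growth of the potential costs -/

theorem exists_running_potential_growth
    {F : Time 𝒢.T → 𝒢.JointState → 𝒢.JointAction → ℝ}
    {Uf : ∀ i : Fin N, Time 𝒢.T → (∀ j : {j : Fin N // j ≠ i}, Euc (𝒢.n j)) →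
      (∀ j : {j : Fin N // j ≠ i}, Euc (𝒢.k j)) → ℝ}
    (hf : ∀ i t x a, 𝒢.f i t x a = F t x a + Uf i t (fun j => x j.1) (fun j => a j.1))
    (x₀ : 𝒢.JointState) (a₀ : 𝒢.JointAction) :
    ∃ C : ℝ, ∀ t x a,
      |F t x a| ≤ |F t x₀ a₀| + C * (1 + ∑ j, ‖x j‖ ^ 2 + ∑ j, ‖a j‖ ^ 2) := by
  choose C hC using 𝒢.growth
  set q : ℝ := ∑ j, (‖x₀ j‖ ^ 2 + ‖a₀ j‖ ^ 2) with hq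
  have hq0 : 0 ≤ q := by positivity
  have hC0 : 0 ≤ ∑ i, C i := Finset.sum_nonneg fun i _ => by
    have := (add_nonneg (abs_nonneg _) (abs_nonneg _)).trans (hC i 𝒢.terminal 0 0)
    simpa using this
  refine ⟨2 * (∑ i, C i) * (1 + q), fun t x a => ?_⟩
  have key := abs_sub_le_of_potential (S := fun i => Euc (𝒢.n i) × Euc (𝒢.k i))
    (w := fun i y => ‖y.1‖ ^ 2 + ‖y.2‖ ^ 2) (fun i y => by positivity)
    (H := fun z => F t (fun j => (z j).1) (fun j => (z j).2))
    (h := fun i z => 𝒢.f i t (fun j => (z j).1) (fun j => (z j).2))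
    (fun i z y => by
      have e₁ : (fun j : {j : Fin N // j ≠ i} => (Function.update z i y j.1).1) =
          (fun j : {j : Fin N // j ≠ i} => (z j.1).1) :=
        funext fun j => by rw [Function.update_of_ne j.2]
      have e₂ : (fun j : {j : Fin N // j ≠ i} => (Function.update z i y j.1).2) =
          (fun j : {j : Fin N // j ≠ i} => (z j.1).2) :=
        funext fun j => by rw [Function.update_of_ne j.2]
      simp only [hf, e₁, e₂, add_sub_add_right_eq_sub])
    (C := C)
    (fun i z => by
      have := hC i t (fun j => (z j).1) (fun j => (z j).2)
      rw [Finset.sum_add_distrib, ← add_assoc]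
      exact (le_add_of_nonneg_right (abs_nonneg _)).trans this)
    (fun j => (x₀ j, a₀ j)) (fun j => (x j, a j))
  simp only [← hq] at key
  rw [Finset.sum_add_distrib] at key
  set p₁ : ℝ := ∑ j, ‖x j‖ ^ 2
  set p₂ : ℝ := ∑ j, ‖a j‖ ^ 2
  have hp₁ : 0 ≤ p₁ := by positivity
  have hp₂ : 0 ≤ p₂ := by positivity
  have h₁ : 1 + q + (p₁ + p₂) ≤ (1 + q) * (1 + p₁ + p₂) := by nlinarith
  have h₂ := mul_le_mul_of_nonneg_left h₁ (mul_nonneg zero_le_two hC0)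
  have h₃ := abs_sub_abs_le_abs_sub (F t x a) (F t x₀ a₀)
  rw [← mul_assoc] at h₂
  linarith

theorem exists_terminal_potential_growth {G : 𝒢.JointState → ℝ}
    {Ug : ∀ i : Fin N, (∀ j : {j : Fin N // j ≠ i}, Euc (𝒢.n j)) → ℝ}
    (hg : ∀ i x, 𝒢.g i x = G x + Ug i (fun j => x j.1)) :
    ∃ D : ℝ, ∀ x, |G x| ≤ D * (1 + ∑ j, ‖x j‖ ^ 2) := by
  choose C hC using 𝒢.growth
  refine ⟨|G 0| + 2 * ∑ i, C i, fun x => ?_⟩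
  have key := abs_sub_le_of_potential (S := fun i => Euc (𝒢.n i))
    (w := fun i y => ‖y‖ ^ 2) (fun i y => by positivity) (H := G) (h := 𝒢.g)
    (fun i z y => by
      have e : (fun j : {j : Fin N // j ≠ i} => Function.update z i y j.1) =
          (fun j : {j : Fin N // j ≠ i} => z j.1) :=
        funext fun j => by rw [Function.update_of_ne j.2]
      simp only [hg, e, add_sub_add_right_eq_sub])
    (C := C)
    (fun i z => by
      have := hC i 𝒢.terminal z 0
      refine (le_add_of_nonneg_left (abs_nonneg _)).trans (this.trans_eq ?_)
      simp)
    0 x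
  have h₀ : 1 + ∑ j, ‖(0 : 𝒢.JointState) j‖ ^ 2 = 1 := by simp
  rw [h₀] at key
  have hp : 0 ≤ ∑ j, ‖x j‖ ^ 2 := by positivity
  have h₃ := abs_sub_abs_le_abs_sub (G x) (G 0)
  nlinarith [mul_nonneg (abs_nonneg (G 0)) hp]

end DistributedGame

theorem theorem3p2 {N : ℕ} (𝒢 : DistributedGame.{u} N) (𝒳 : 𝒢.StateProcesses)
    (F : Time 𝒢.T → 𝒢.JointState → 𝒢.JointAction → ℝ)
    (G : 𝒢.JointState → ℝ)
    (Uf : ∀ i : Fin N, Time 𝒢.T → (∀ j : {j : Fin N // j ≠ i}, Euc (𝒢.n j)) →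
      (∀ j : {j : Fin N // j ≠ i}, Euc (𝒢.k j)) → ℝ)
    (Ug : ∀ i : Fin N, (∀ j : {j : Fin N // j ≠ i}, Euc (𝒢.n j)) → ℝ)
    (hF : Measurable fun z : Time 𝒢.T × 𝒢.JointState × 𝒢.JointAction => F z.1 z.2.1 z.2.2)
    (hG : Measurable G)
    (hUf : ∀ i, Measurable fun z : Time 𝒢.T × (∀ j : {j : Fin N // j ≠ i}, Euc (𝒢.n j)) ×
      (∀ j : {j : Fin N // j ≠ i}, Euc (𝒢.k j)) => Uf i z.1 z.2.1 z.2.2)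
    (hUg : ∀ i, Measurable (Ug i))
    (hf_decomp : ∀ i t x a,
      𝒢.f i t x a = F t x a + Uf i t (fun j => x j.1) (fun j => a j.1))
    (hg_decomp : ∀ i x, 𝒢.g i x = G x + Ug i (fun j => x j.1))
    (hF_int : ∃ (x₀ : 𝒢.JointState) (a₀ : 𝒢.JointAction),
      Integrable (fun t : Time 𝒢.T => F t x₀ a₀) (timeVol 𝒢.T)) :
    (∀ i t x φ, 𝒳.CostWellDefined (𝒢.f i) (𝒢.g i) t x φ) ∧
    (∀ t x φ, 𝒳.CostWellDefined F G t x φ) ∧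
    𝒳.toGame.IsMPG ∧
    𝒳.toGame.IsMarkovPotential (fun s φ => 𝒳.expectedCost F G s.1 s.2 φ) := by
  have hWf : ∀ i t x φ, 𝒳.CostWellDefined (𝒢.f i) (𝒢.g i) t x φ := by
    intro i
    obtain ⟨C, hC⟩ := 𝒢.growth i
    refine 𝒳.costWellDefined_of_growth (𝒢.f_measurable i) (𝒢.g_measurable i)
      (κ := 0) (integrable_zero _ ℝ _) (C := C) (D := C) (fun s y a => ?_) (fun y => ?_)
    · rw [Pi.zero_apply, zero_add]
      exact (le_add_of_nonneg_right (abs_nonneg _)).trans (hC s y a)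
    · refine (le_add_of_nonneg_left (abs_nonneg _)).trans ((hC 𝒢.terminal y 0).trans_eq ?_)
      simp
  have hWF : ∀ t x φ, 𝒳.CostWellDefined F G t x φ := by
    obtain ⟨x₀, a₀, hint⟩ := hF_int
    obtain ⟨C, hC⟩ := DistributedGame.exists_running_potential_growth hf_decomp x₀ a₀
    obtain ⟨D, hD⟩ := DistributedGame.exists_terminal_potential_growth hg_decomp
    exact 𝒳.costWellDefined_of_growth hF hG hint.abs hC hD
  have hpot : 𝒳.toGame.IsMarkovPotential (fun s φ => 𝒳.expectedCost F G s.1 s.2 φ) := by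
    rintro ⟨t, x⟩ i (φ : ∀ j, 𝒢.Policy j) (φ' : 𝒢.Policy i)
    -- `V_i - Φ` is the expected cost of the terms that do not involve agent `i`.
    have hsub : ∀ ψ : ∀ j, 𝒢.Policy j,
        𝒳.expectedCost (𝒢.f i) (𝒢.g i) t x ψ - 𝒳.expectedCost F G t x ψ =
          𝒳.expectedCost (fun s y a => Uf i s (fun j => y j.1) (fun j => a j.1))
            (fun y => Ug i (fun j => y j.1)) t x ψ := by
      intro ψ
      rw [𝒳.expectedCost_sub (hWf i t x ψ) (hWF t x ψ)]
      simp only [hf_decomp, hg_decomp, add_sub_cancel_left]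
    have h₁ := hsub (Function.update φ i φ')
    rw [𝒳.expectedCost_update i (Uf i) (Ug i), ← hsub φ] at h₁
    change 𝒳.expectedCost F G t x (Function.update φ i φ') - 𝒳.expectedCost F G t x φ =
      𝒳.expectedCost (𝒢.f i) (𝒢.g i) t x (Function.update φ i φ') -
        𝒳.expectedCost (𝒢.f i) (𝒢.g i) t x φ
    linarith
  exact ⟨hWf, hWF, ⟨_, hpot⟩, hpot⟩
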